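/- All graphs are finite and simple, and all trees are finite. A \emph{tree decomposition} of a graph $G$ is a tree $T$ together with bags $B_x\subseteq V(G)$, one for each node $x$ of $T$, such that for every $v\in V(G)$ the set $\{x\in V(T): v\in B_x\}$ induces a non-empty subtree of $T$, and for every edge $vw\in E(G)$ some bag contains both $v$ and $w$. Its \emph{width} is $\max_x |B_x|-1$, and the \emph{treewidth} $\mathrm{tw}(G)$ is the minimum width of a tree decomposition of $G$. A \emph{branch decomposition} of $G$ is a pair $(T,\theta)$ where $T$ is a tree in which every node has degree $3$ or $1$, and $\theta$ is a bijection from $E(G)$ to the set of leaves (nodes of degree $1$) of $T$. A vertex $v$ of $G$ is \emph{across} an edge $e$ of $T$ if there are edges of $G$ incident with $v$ that $\theta$ maps to leaves in different components of $T-e$. The \emph{order} of $e$ is the number of vertices of $G$ across $e$, and the \emph{width} of $(T,\theta)$ is the maximum order of an edge of $T$. The \emph{branchwidth} $\mathrm{bw}(G)$ is the minimum width of a branch decomposition of $G$; if $|E(G)|\le 1$, then $G$ has no branch decomposition, and $\mathrm{bw}(G)=0$. \textbf{Lemma.} For every graph $G$ with $\mathrm{bw}(G)\ge 2$, $$\mathrm{bw}(G)\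 \le\ \mathrm{tw}(G)+1\ \le\ \tfrac32\,\mathrm{bw}(G).$$ -/

import Mathlib

universe u

/-- A tree decomposition of a graph `G`: a finite tree `T` together with bags of vertices of `G`
indexed by the nodes of `T`. (A finite tree has an isomorphic copy in every universe, so taking the
nodes in the universe of `V` is no restriction.) -/
structure TreeDecomposition {V : Type u} (G : SimpleGraph V) where
  /-- The type of nodes of the tree. -/
  Node : Type u
  finite_node : Finite Node
  /-- The underlying tree. -/
  T : SimpleGraph Node
  isTree : T.IsTree
  /-- The bag indexed by a node. -/
  bag : Node → Finset V
  /-- The nodes whose bags contain a given vertex induce a non-empty subtree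
  (`SimpleGraph.IsTree` includes non-emptiness). -/
  isTree_induce : ∀ v : V, (T.induce {x : Node | v ∈ bag x}).IsTree
  /-- The two ends of each edge lie in a common bag. -/
  exists_bag : ∀ v w : V, G.Adj v w → ∃ x : Node, v ∈ bag x ∧ w ∈ bag x

/-- The width of a tree decomposition: the size of a largest bag, minus one. It is an integer, so
that nothing is truncated when all bags are empty. -/
noncomputable def TreeDecomposition.width {V : Type u} {G : SimpleGraph V}
    (D : TreeDecomposition G) : ℤ :=
  ((⨆ x : D.Node, (D.bag x).card : ℕ) : ℤ) - 1

/-- The treewidth of a finite graph: the minimum width over all its tree decompositions. -/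
noncomputable def treewidth {V : Type u} [Finite V] (G : SimpleGraph V) : ℤ :=
  sInf (Set.range fun D : TreeDecomposition G => D.width)

/-- A branch decomposition of a graph `G`: a finite tree in which each node has degree `3` or `1`,
and a bijection from the edges of `G` to the leaves, that is, to the nodes of degree `1`. -/
structure BranchDecomposition {V : Type u} (G : SimpleGraph V) where
  /-- The type of nodes of the tree. -/
  Node : Type u
  finite_node : Finite Node
  /-- The underlying tree. -/
  T : SimpleGraph Node
  isTree : T.IsTree
  degree_eq : ∀ x : Node, (T.neighborSet x).ncard = 3 ∨ (T.neighborSet x).ncard = 1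
  /-- The bijection from the edges of `G` to the leaves of the tree. -/
  leaf : G.edgeSet ≃ {x : Node // (T.neighborSet x).ncard = 1}

namespace BranchDecomposition

variable {V : Type u} {G : SimpleGraph V}

/-- A vertex `v` of `G` is across an edge `t` of the tree `T` if two edges of `G` incident with `v`
are mapped to leaves in different components of `T - t`. -/
def Across (D : BranchDecomposition G) (v : V) (t : Sym2 D.Node) : Prop :=
  ∃ e f : G.edgeSet, v ∈ (e : Sym2 V) ∧ v ∈ (f : Sym2 V) ∧
    ¬ (D.T.deleteEdges {t}).Reachable (D.leaf e : D.Node) (D.leaf f : D.Node)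

/-- The order of an edge of the tree: the number of vertices of `G` across it. -/
noncomputable def order (D : BranchDecomposition G) (t : Sym2 D.Node) : ℕ :=
  {v : V | D.Across v t}.ncard

/-- The width of a branch decomposition: the maximum order of an edge of the tree. -/
noncomputable def width (D : BranchDecomposition G) : ℕ :=
  ⨆ t : D.T.edgeSet, D.order t

end BranchDecomposition

/-- The branchwidth of a finite graph: the minimum width over all its branch decompositions, and
`0` if the graph has at most one edge (in which case it has no branch decomposition). -/
noncomputable def branchwidth {V : Type u} [Finite V] (G : SimpleGraph V) : ℕ :=
  if G.edgeSet.ncard ≤ 1 then 0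
  else sInf (Set.range fun D : BranchDecomposition G => D.width)

/-! Each kind of decomposition is turned into the other.

From a tree decomposition with bags of size at most `k`, assign each edge to a bag containing both
its ends. The edges at one node can be merged one by one, every intermediate set having its boundary
inside the bag. Then prune the tree leaf by leaf, merging the edges of a leaf into those of its
neighbour. A vertex of the merged set that also meets an outside edge lies in the neighbour's bag,
because bags form subtrees; so boundaries never exceed `k` (`IsTree.binaryMergeable_univ`). The
merging history is a binary tree, and this is a branch decomposition whose orders are bounded by
those boundaries (`exists_order_le`).

From a branch decomposition of width `w`, let `v` belong to the bag of every node on a path between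
leaves of edges at `v`. A leaf has a bag of size at most 2. At a node of degree 3, each vertex of
the bag is across at least two of the three tree edges, so `2|bag| ≤ 3w` (`two_mul_ncard_span_le`).
Isolated vertices of the graph get new singleton bags. -/

namespace SimpleGraph

/-! ### Joining two trees by an edge. -/

variable {N₁ : Type*} {N₂ : Type*} (T₁ : SimpleGraph N₁) (T₂ : SimpleGraph N₂) (a : N₁) (b : N₂)

/-- The disjoint union of two graphs, with one edge added between them. -/
def joinEdge : SimpleGraph (N₁ ⊕ N₂) := (T₁ ⊕g T₂) ⊔ edge (Sum.inl a) (Sum.inr b)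

variable {T₁ T₂ a b}

@[simp]
theorem joinEdge_adj_inl_inl {x y : N₁} :
    (joinEdge T₁ T₂ a b).Adj (Sum.inl x) (Sum.inl y) ↔ T₁.Adj x y := by
  simp [joinEdge, edge_adj]

@[simp]
theorem joinEdge_adj_inr_inr {x y : N₂} :
    (joinEdge T₁ T₂ a b).Adj (Sum.inr x) (Sum.inr y) ↔ T₂.Adj x y := by
  simp [joinEdge, edge_adj]

@[simp]
theorem joinEdge_adj_inl_inr {x : N₁} {y : N₂} :
    (joinEdge T₁ T₂ a b).Adj (Sum.inl x) (Sum.inr y) ↔ x = a ∧ y = b := by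
  simp [joinEdge, edge_adj, eq_comm]

@[simp]
theorem joinEdge_adj_inr_inl {x : N₂} {y : N₁} :
    (joinEdge T₁ T₂ a b).Adj (Sum.inr x) (Sum.inl y) ↔ y = a ∧ x = b := by
  rw [adj_comm, joinEdge_adj_inl_inr]

theorem IsTree.joinEdge [Finite N₁] [Finite N₂] (h₁ : T₁.IsTree) (h₂ : T₂.IsTree) :
    (joinEdge T₁ T₂ a b).IsTree := by
  rw [isTree_iff_connected_and_card] at h₁ h₂ ⊢
  refine ⟨h₁.1.sum_sup_edge h₂.1, ?_⟩
  have hE : (SimpleGraph.joinEdge T₁ T₂ a b).edgeSet =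
      insert s(Sum.inl a, Sum.inr b) (T₁ ⊕g T₂).edgeSet := by
    ext e
    induction e with
    | _ x y => cases x <;> cases y <;> simp [eq_comm]
  have hn : s(Sum.inl a, Sum.inr b) ∉ (T₁ ⊕g T₂).edgeSet := by simp
  have hc : Nat.card (T₁ ⊕g T₂).edgeSet = Nat.card T₁.edgeSet + Nat.card T₂.edgeSet := by
    rw [Nat.card_congr edgeSetSumEquiv, Nat.card_sum]
  rw [hE, Nat.card_coe_set_eq, Set.ncard_insert_of_notMem hn, ← Nat.card_coe_set_eq, hc,
    Nat.card_sum]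
  omega

theorem ncard_neighborSet_joinEdge_inl [Finite N₁] (x : N₁) [Decidable (x = a)] :
    ((joinEdge T₁ T₂ a b).neighborSet (Sum.inl x)).ncard =
      (T₁.neighborSet x).ncard + if x = a then 1 else 0 := by
  split_ifs with h
  · have : (joinEdge T₁ T₂ a b).neighborSet (Sum.inl x) =
        insert (Sum.inr b) (Sum.inl '' T₁.neighborSet x) := by
      ext y; cases y <;> simp [h]
    rw [this, Set.ncard_insert_of_notMem (by simp), Set.ncard_image_of_injective _ Sum.inl_injective]
  · have : (joinEdge T₁ T₂ a b).neighborSet (Sum.inl x) = Sum.inl '' T₁.neighborSet x := by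
      ext y; cases y <;> simp [h]
    rw [this, Set.ncard_image_of_injective _ Sum.inl_injective, add_zero]

theorem ncard_neighborSet_joinEdge_inr [Finite N₂] (x : N₂) [Decidable (x = b)] :
    ((joinEdge T₁ T₂ a b).neighborSet (Sum.inr x)).ncard =
      (T₂.neighborSet x).ncard + if x = b then 1 else 0 := by
  split_ifs with h
  · have : (joinEdge T₁ T₂ a b).neighborSet (Sum.inr x) =
        insert (Sum.inl a) (Sum.inr '' T₂.neighborSet x) := by
      ext y; cases y <;> simp [h]
    rw [this, Set.ncard_insert_of_notMem (by simp), Set.ncard_image_of_injective _ Sum.inr_injective]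
  · have : (joinEdge T₁ T₂ a b).neighborSet (Sum.inr x) = Sum.inr '' T₂.neighborSet x := by
      ext y; cases y <;> simp [h]
    rw [this, Set.ncard_image_of_injective _ Sum.inr_injective, add_zero]

theorem Reachable.deleteEdges_joinEdge_inl {x y : N₁} {s : Set (Sym2 N₁)}
    {t : Set (Sym2 (N₁ ⊕ N₂))} (hs : ∀ e, e.map Sum.inl ∈ t → e ∈ s)
    (h : (T₁.deleteEdges s).Reachable x y) :
    ((joinEdge T₁ T₂ a b).deleteEdges t).Reachable (Sum.inl x) (Sum.inl y) := by
  refine h.map (G' := (joinEdge T₁ T₂ a b).deleteEdges t) ⟨Sum.inl, fun {x y} h => ?_⟩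
  rw [deleteEdges_adj] at h ⊢
  exact ⟨joinEdge_adj_inl_inl.2 h.1, fun h' => h.2 (hs s(x, y) h')⟩

theorem Reachable.deleteEdges_joinEdge_inr {x y : N₂} {s : Set (Sym2 N₂)}
    {t : Set (Sym2 (N₁ ⊕ N₂))} (hs : ∀ e, e.map Sum.inr ∈ t → e ∈ s)
    (h : (T₂.deleteEdges s).Reachable x y) :
    ((joinEdge T₁ T₂ a b).deleteEdges t).Reachable (Sum.inr x) (Sum.inr y) := by
  refine h.map (G' := (joinEdge T₁ T₂ a b).deleteEdges t) ⟨Sum.inr, fun {x y} h => ?_⟩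
  rw [deleteEdges_adj] at h ⊢
  exact ⟨joinEdge_adj_inr_inr.2 h.1, fun h' => h.2 (hs s(x, y) h')⟩

theorem reachable_deleteEdges_joinEdge {t : Set (Sym2 (N₁ ⊕ N₂))}
    (h : s(Sum.inl a, Sum.inr b) ∉ t) :
    ((joinEdge T₁ T₂ a b).deleteEdges t).Reachable (Sum.inl a) (Sum.inr b) :=
  Adj.reachable (by rw [deleteEdges_adj]; exact ⟨by simp, h⟩)

end SimpleGraph

/-! ### Rooted cubic trees with labelled leaves, and their gluing. -/

open Classical in
/-- The degree of a node `x` of a graph in which the node `r` is given `d` additional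
half-edges. -/
noncomputable def SimpleGraph.rootedDegree {N : Type*} (T : SimpleGraph N) (r : N) (d : ℕ)
    (x : N) : ℕ :=
  (T.neighborSet x).ncard + if x = r then d else 0

/-- A finite rooted tree in which each node has degree `3` or `1`, where the root is given `d`
additional half-edges, and whose nodes of degree `1` are labelled bijectively by `F`. For each edge
of the tree, the labels on the side not containing the root form a set with property `P`. -/
structure RootedBranchTree {α : Type u} (P : Set α → Prop) (F : Set α) (d : ℕ) where
  /-- The type of nodes of the tree. -/
  Node : Type u
  finite_node : Finite Node
  /-- The underlying tree. -/
  T : SimpleGraph Node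
  isTree : T.IsTree
  /-- The root of the tree. -/
  root : Node
  /-- The node carrying a label. -/
  leaf : α → Node
  injOn_leaf : Set.InjOn leaf F
  degree_eq : ∀ x, T.rootedDegree root d x = 3 ∨ T.rootedDegree root d x = 1
  degree_eq_one_iff : ∀ x, T.rootedDegree root d x = 1 ↔ x ∈ leaf '' F
  exists_side : ∀ t ∈ T.edgeSet, ∃ A ⊆ F, P A ∧
    (∀ e ∈ A, ∀ f ∈ A, (T.deleteEdges {t}).Reachable (leaf e) (leaf f)) ∧
    ∀ e ∈ F \ A, (T.deleteEdges {t}).Reachable (leaf e) root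

namespace RootedBranchTree

variable {α : Type u} {P : Set α → Prop} {F F₁ F₂ : Set α} {d : ℕ}

theorem nonempty_singleton (e : α) : Nonempty (RootedBranchTree P {e} 1) :=
  ⟨{ Node := PUnit
     finite_node := inferInstance
     T := ⊥
     isTree := .of_subsingleton
     root := ⟨⟩
     leaf := fun _ => ⟨⟩
     injOn_leaf := by simp
     degree_eq := by simp [SimpleGraph.rootedDegree, SimpleGraph.neighborSet]
     degree_eq_one_iff := by simp [SimpleGraph.rootedDegree, SimpleGraph.neighborSet]
     exists_side := by simp }⟩

theorem nonempty_empty : Nonempty (RootedBranchTree P (∅ : Set α) 3) :=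
  ⟨{ Node := PUnit
     finite_node := inferInstance
     T := ⊥
     isTree := .of_subsingleton
     root := ⟨⟩
     leaf := fun _ => ⟨⟩
     injOn_leaf := by simp
     degree_eq := by simp [SimpleGraph.rootedDegree, SimpleGraph.neighborSet]
     degree_eq_one_iff := by simp [SimpleGraph.rootedDegree, SimpleGraph.neighborSet]
     exists_side := by simp }⟩

-- The new edge between the roots uses up one half-edge on each side, so all degrees are preserved.
-- The side of the new edge away from the root carries exactly `F₂`. An old edge keeps its old side
-- `A`: the other tree hangs from the root, or contains it, and so stays on the root's side.
open SimpleGraph in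
open Classical in
theorem nonempty_union (D₁ : RootedBranchTree P F₁ (d + 1)) (D₂ : RootedBranchTree P F₂ 1)
    (hd : Disjoint F₁ F₂) (hP : P F₂) : Nonempty (RootedBranchTree P (F₁ ∪ F₂) d) := by
  have := D₁.finite_node
  have := D₂.finite_node
  let leaf : α → D₁.Node ⊕ D₂.Node :=
    fun e => if e ∈ F₂ then Sum.inr (D₂.leaf e) else Sum.inl (D₁.leaf e)
  have hl₁ : ∀ e ∈ F₁, leaf e = Sum.inl (D₁.leaf e) := fun e he =>
    if_neg (Set.disjoint_left.1 hd he)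
  have hl₂ : ∀ e ∈ F₂, leaf e = Sum.inr (D₂.leaf e) := fun e he => if_pos he
  have hdeg₁ : ∀ x : D₁.Node,
      (joinEdge D₁.T D₂.T D₁.root D₂.root).rootedDegree (Sum.inl D₁.root) d (Sum.inl x) =
      D₁.T.rootedDegree D₁.root (d + 1) x := by
    intro x
    rw [rootedDegree, rootedDegree, ncard_neighborSet_joinEdge_inl]
    by_cases h : x = D₁.root <;> simp [h]
    omega
  have hdeg₂ : ∀ x : D₂.Node,
      (joinEdge D₁.T D₂.T D₁.root D₂.root).rootedDegree (Sum.inl D₁.root) d (Sum.inr x) =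
      D₂.T.rootedDegree D₂.root 1 x := by
    intro x
    rw [rootedDegree, rootedDegree, ncard_neighborSet_joinEdge_inr]
    simp
  have hi₁ : ∀ x, Sum.inl x ∈ leaf '' (F₁ ∪ F₂) ↔ x ∈ D₁.leaf '' F₁ := by
    intro x
    constructor
    · rintro ⟨e, he | he, hx⟩
      · rw [hl₁ e he] at hx; exact ⟨e, he, Sum.inl_injective hx⟩
      · rw [hl₂ e he] at hx; cases hx
    · rintro ⟨e, he, rfl⟩
      exact ⟨e, .inl he, hl₁ e he⟩
  have hi₂ : ∀ x, Sum.inr x ∈ leaf '' (F₁ ∪ F₂) ↔ x ∈ D₂.leaf '' F₂ := by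
    intro x
    constructor
    · rintro ⟨e, he | he, hx⟩
      · rw [hl₁ e he] at hx; cases hx
      · rw [hl₂ e he] at hx; exact ⟨e, he, Sum.inr_injective hx⟩
    · rintro ⟨e, he, rfl⟩
      exact ⟨e, .inr he, hl₂ e he⟩
  have hr₁ : ∀ (t : Set (Sym2 (D₁.Node ⊕ D₂.Node))), (∀ e : Sym2 D₁.Node, e.map Sum.inl ∉ t) →
      ∀ x y, ((joinEdge D₁.T D₂.T D₁.root D₂.root).deleteEdges t).Reachable
        (Sum.inl x) (Sum.inl y) := by
    intro t ht x y
    refine Reachable.deleteEdges_joinEdge_inl (s := ∅) (fun e he => (ht e he).elim) ?_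
    rw [deleteEdges_empty]
    exact D₁.isTree.connected x y
  have hr₂ : ∀ (t : Set (Sym2 (D₁.Node ⊕ D₂.Node))), (∀ e : Sym2 D₂.Node, e.map Sum.inr ∉ t) →
      ∀ x y, ((joinEdge D₁.T D₂.T D₁.root D₂.root).deleteEdges t).Reachable
        (Sum.inr x) (Sum.inr y) := by
    intro t ht x y
    refine Reachable.deleteEdges_joinEdge_inr (s := ∅) (fun e he => (ht e he).elim) ?_
    rw [deleteEdges_empty]
    exact D₂.isTree.connected x y
  have hnew : ∃ A ⊆ F₁ ∪ F₂, P A ∧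
      (∀ e ∈ A, ∀ f ∈ A, ((joinEdge D₁.T D₂.T D₁.root D₂.root).deleteEdges
        {s(Sum.inl D₁.root, Sum.inr D₂.root)}).Reachable (leaf e) (leaf f)) ∧
      ∀ e ∈ (F₁ ∪ F₂) \ A, ((joinEdge D₁.T D₂.T D₁.root D₂.root).deleteEdges
        {s(Sum.inl D₁.root, Sum.inr D₂.root)}).Reachable (leaf e) (Sum.inl D₁.root) := by
    refine ⟨F₂, Set.subset_union_right, hP, fun e he f hf => ?_, fun e he => ?_⟩
    · rw [hl₂ e he, hl₂ f hf]
      refine hr₂ _ (fun e => ?_) _ _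
      induction e with | _ x y => simp
    · rw [hl₁ e (he.1.resolve_right he.2)]
      refine hr₁ _ (fun e => ?_) _ _
      induction e with | _ x y => simp
  refine ⟨{ Node := D₁.Node ⊕ D₂.Node
            finite_node := inferInstance
            T := joinEdge D₁.T D₂.T D₁.root D₂.root
            isTree := D₁.isTree.joinEdge D₂.isTree
            root := Sum.inl D₁.root
            leaf := leaf
            injOn_leaf := ?_
            degree_eq := ?_
            degree_eq_one_iff := ?_
            exists_side := ?_ }⟩
  · rintro e (he | he) f (hf | hf) h
    · rw [hl₁ e he, hl₁ f hf] at h; exact D₁.injOn_leaf he hf (Sum.inl_injective h)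
    · rw [hl₁ e he, hl₂ f hf] at h; cases h
    · rw [hl₂ e he, hl₁ f hf] at h; cases h
    · rw [hl₂ e he, hl₂ f hf] at h; exact D₂.injOn_leaf he hf (Sum.inr_injective h)
  · rintro (x | x)
    · rw [hdeg₁]; exact D₁.degree_eq x
    · rw [hdeg₂]; exact D₂.degree_eq x
  · rintro (x | x)
    · rw [hdeg₁, hi₁]; exact D₁.degree_eq_one_iff x
    · rw [hdeg₂, hi₂]; exact D₂.degree_eq_one_iff x
  · intro t ht
    induction t with
    | _ x y =>
      rcases x with x | x <;> rcases y with y | y <;> rw [mem_edgeSet] at ht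
      · obtain ⟨A, hA, hPA, h₁, h₂⟩ := D₁.exists_side s(x, y) (joinEdge_adj_inl_inl.1 ht)
        have hs : ∀ e : Sym2 D₁.Node,
            e.map Sum.inl ∈ ({s(Sum.inl x, Sum.inl y)} : Set (Sym2 (D₁.Node ⊕ D₂.Node))) →
            e ∈ ({s(x, y)} : Set (Sym2 D₁.Node)) := fun e he =>
          Sym2.map.injective Sum.inl_injective (by simpa using he)
        refine ⟨A, hA.trans Set.subset_union_left, hPA, fun e he f hf => ?_, ?_⟩
        · rw [hl₁ e (hA he), hl₁ f (hA hf)]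
          exact (h₁ e he f hf).deleteEdges_joinEdge_inl hs
        · rintro e ⟨he | he, heA⟩
          · rw [hl₁ e he]
            exact (h₂ e ⟨he, heA⟩).deleteEdges_joinEdge_inl hs
          · rw [hl₂ e he]
            refine (hr₂ _ (fun e => ?_) _ D₂.root).trans
              (reachable_deleteEdges_joinEdge (by simp)).symm
            induction e with | _ x y => simp
      · obtain ⟨rfl, rfl⟩ := joinEdge_adj_inl_inr.1 ht
        exact hnew
      · obtain ⟨rfl, rfl⟩ := joinEdge_adj_inr_inl.1 ht
        rw [Sym2.eq_swap]
        exact hnew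
      · obtain ⟨A, hA, hPA, h₁, h₂⟩ := D₂.exists_side s(x, y) (joinEdge_adj_inr_inr.1 ht)
        have hs : ∀ e : Sym2 D₂.Node,
            e.map Sum.inr ∈ ({s(Sum.inr x, Sum.inr y)} : Set (Sym2 (D₁.Node ⊕ D₂.Node))) →
            e ∈ ({s(x, y)} : Set (Sym2 D₂.Node)) := fun e he =>
          Sym2.map.injective Sum.inr_injective (by simpa using he)
        refine ⟨A, hA.trans Set.subset_union_right, hPA, fun e he f hf => ?_, ?_⟩
        · rw [hl₂ e (hA he), hl₂ f (hA hf)]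
          exact (h₁ e he f hf).deleteEdges_joinEdge_inr hs
        · rintro e ⟨he | he, heA⟩
          · rw [hl₁ e he]
            refine hr₁ _ (fun e => ?_) _ _
            induction e with | _ x y => simp
          · rw [hl₂ e he]
            exact ((h₂ e ⟨he, heA⟩).deleteEdges_joinEdge_inr hs).trans
              (reachable_deleteEdges_joinEdge (by simp)).symm

end RootedBranchTree

/-! ### Merging edge sets, and the resulting branch decompositions. -/

/-- The sets obtained from singletons by disjoint unions, all intermediate sets having property
`P`. -/
inductive BinaryMergeable {α : Type u} (P : Set α → Prop) : Set α → Prop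
  | singleton (e : α) (h : P {e}) : BinaryMergeable P {e}
  | union (A B : Set α) (hA : BinaryMergeable P A) (hB : BinaryMergeable P B)
      (hd : Disjoint A B) (h : P (A ∪ B)) : BinaryMergeable P (A ∪ B)

namespace BinaryMergeable

variable {α : Type u} {P : Set α → Prop} {F : Set α}

theorem prop (h : BinaryMergeable P F) : P F := by
  cases h <;> assumption

theorem nonempty_rootedBranchTree (h : BinaryMergeable P F) :
    Nonempty (RootedBranchTree P F 1) := by
  induction h with
  | singleton e h => exact RootedBranchTree.nonempty_singleton e
  | union A B hA hB hd h ihA ihB =>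
    obtain ⟨D₁⟩ := ihA
    obtain ⟨D₂⟩ := ihB
    -- A single unlabelled node with three half-edges: two receive the trees of `A` and `B`, the
    -- third remains for the parent.
    obtain ⟨D₀⟩ := RootedBranchTree.nonempty_empty (P := P)
    obtain ⟨D⟩ := RootedBranchTree.nonempty_union D₀ D₁ (Set.empty_disjoint A) hA.prop
    rw [Set.empty_union] at D
    exact RootedBranchTree.nonempty_union D D₂ hd hB.prop

end BinaryMergeable

namespace SimpleGraph

variable {V : Type u} {G : SimpleGraph V}

/-- The vertices incident both with an edge in `A` and with an edge outside `A`. -/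
def edgeBoundary (G : SimpleGraph V) (A : Set G.edgeSet) : Set V :=
  {v | ∃ e ∈ A, ∃ f ∉ A, v ∈ (e : Sym2 V) ∧ v ∈ (f : Sym2 V)}

end SimpleGraph

namespace BranchDecomposition

variable {V : Type u} {G : SimpleGraph V}

theorem exists_order_le [Finite V] {k : ℕ}
    (D : RootedBranchTree (fun A => (G.edgeBoundary A).ncard ≤ k) Set.univ 0) :
    ∃ B : BranchDecomposition G, ∀ t ∈ B.T.edgeSet, B.order t ≤ k := by
  have hdeg : ∀ x, D.T.rootedDegree D.root 0 x = (D.T.neighborSet x).ncard := fun x => by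
    simp [SimpleGraph.rootedDegree]
  let leaf : G.edgeSet → {x : D.Node // (D.T.neighborSet x).ncard = 1} := fun e =>
    ⟨D.leaf e, by rw [← hdeg, D.degree_eq_one_iff]; exact ⟨e, trivial, rfl⟩⟩
  have hleaf : Function.Bijective leaf := by
    refine ⟨fun e f h => D.injOn_leaf trivial trivial (congrArg Subtype.val h), fun x => ?_⟩
    obtain ⟨e, -, he⟩ := (D.degree_eq_one_iff x).1 ((hdeg x).trans x.2)
    exact ⟨e, Subtype.ext he⟩
  refine ⟨{ Node := D.Node
            finite_node := D.finite_node
            T := D.T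
            isTree := D.isTree
            degree_eq := fun x => by simpa only [hdeg] using D.degree_eq x
            leaf := Equiv.ofBijective leaf hleaf }, fun t ht => ?_⟩
  -- Two edges at `v` separated by `t` cannot both lie in `A` or both outside it, so `v` is in the
  -- boundary of `A`.
  obtain ⟨A, -, hA, h₁, h₂⟩ := D.exists_side t ht
  refine (Set.ncard_le_ncard ?_ (Set.toFinite _)).trans hA
  rintro v ⟨e, f, he, hf, hef⟩
  change ¬ (D.T.deleteEdges {t}).Reachable (D.leaf e) (D.leaf f) at hef
  by_cases heA : e ∈ A <;> by_cases hfA : f ∈ A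
  · exact (hef (h₁ e heA f hfA)).elim
  · exact ⟨e, heA, f, hfA, he, hf⟩
  · exact ⟨f, hfA, e, heA, hf, he⟩
  · exact (hef ((h₂ e ⟨trivial, heA⟩).trans (h₂ f ⟨trivial, hfA⟩).symm)).elim

theorem exists_width_le [Finite V] {k : ℕ}
    (h : BinaryMergeable (fun A => (G.edgeBoundary A).ncard ≤ k) Set.univ)
    (hE : 1 < G.edgeSet.ncard) : ∃ B : BranchDecomposition G, B.width ≤ k := by
  suffices Nonempty
      (RootedBranchTree (fun A => (G.edgeBoundary A).ncard ≤ k) Set.univ 0) by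
    obtain ⟨B, hB⟩ := exists_order_le this.some
    exact ⟨B, ciSup_le' fun t => hB t t.2⟩
  generalize hU : (Set.univ : Set G.edgeSet) = U at h
  cases h with
  | singleton e =>
    rw [← Nat.card_coe_set_eq, ← Set.ncard_univ, hU, Set.ncard_singleton] at hE
    exact (lt_irrefl _ hE).elim
  | union A B hA hB hd =>
    obtain ⟨DA⟩ := hA.nonempty_rootedBranchTree
    obtain ⟨DB⟩ := hB.nonempty_rootedBranchTree
    -- At the last merge no half-edge may remain, so the two roots are joined directly, without a
    -- node between them.
    exact RootedBranchTree.nonempty_union DA DB hd hB.prop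

end BranchDecomposition

/-! ### From tree decompositions to branch decompositions. -/

namespace SimpleGraph

variable {V : Type u} {G : SimpleGraph V}

theorem Walk.IsPath.exists_isPath_support_eq_map_val {N : Type*} {T : SimpleGraph N} {s : Set N}
    {a b : s} {p : (T.induce s).Walk a b} (hp : p.IsPath) :
    ∃ q : T.Walk a b, q.IsPath ∧ q.support = p.support.map Subtype.val :=
  ⟨p.map (Embedding.induce s).toHom, hp.map Subtype.val_injective, Walk.support_map ..⟩

/-- If each edge of `G` is assigned to a node of a tree whose bags form subtrees, such that a
vertex incident with edges assigned to two different nodes lies in the bags of both, and the edges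
assigned to each node can be merged, then all edges can be merged. -/
theorem IsTree.binaryMergeable_univ [Finite V] {k : ℕ} (hE : (Set.univ : Set G.edgeSet).Nonempty)
    (n : ℕ) : ∀ {N : Type u} [Finite N] {T : SimpleGraph N} (_ : T.IsTree) (_ : Nat.card N = n)
      (bag : N → Finset V) (_ : ∀ x, (bag x).card ≤ k)
      (_ : ∀ v a b, v ∈ bag a → v ∈ bag b → ∀ p : T.Walk a b, p.IsPath → ∀ z ∈ p.support, v ∈ bag z)
      (ρ : G.edgeSet → N)
      (_ : ∀ (v : V) (e f : G.edgeSet), v ∈ (e : Sym2 V) → v ∈ (f : Sym2 V) → ρ e ≠ ρ f →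
        v ∈ bag (ρ e))
      (_ : ∀ x, (ρ ⁻¹' {x}).Nonempty →
        BinaryMergeable (fun A => (G.edgeBoundary A).ncard ≤ k) (ρ ⁻¹' {x})),
      BinaryMergeable (fun A => (G.edgeBoundary A).ncard ≤ k) (Set.univ : Set G.edgeSet) := by
  classical
  induction n with
  | zero =>
    intro N _ T hT hn
    have := hT.connected.nonempty
    exact (Nat.card_pos.ne' hn).elim
  | succ n ih =>
    intro N _ T hT hn bag hk hbag ρ hρ hm
    rcases subsingleton_or_nontrivial N with hN | hN
    · obtain ⟨e, -⟩ := hE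
      have h : ρ ⁻¹' {ρ e} = Set.univ := Set.eq_univ_of_forall fun f => Subsingleton.elim _ _
      rw [← h]
      exact hm _ ⟨e, rfl⟩
    have := Fintype.ofFinite N
    obtain ⟨x, hx⟩ := hT.exists_vert_degree_one_of_nontrivial
    obtain ⟨p, hxp, hp⟩ := degree_eq_one_iff_existsUnique_adj.1 hx
    have hT' : (T.induce {x}ᶜ).IsTree :=
      ⟨hT.connected.induce_compl_singleton_of_degree_eq_one hx, hT.isAcyclic.induce _⟩
    have hpx : p ≠ x := hxp.ne'
    -- The edges of the leaf `x` move to its neighbour `p`. Their ends need not lie in `bag p`,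
    -- which is why the induction only controls vertices shared by edges at different nodes.
    let ρ' : G.edgeSet → ({x}ᶜ : Set N) := fun e =>
      if h : ρ e = x then ⟨p, hpx⟩ else ⟨ρ e, h⟩
    have hρ'x : ∀ e, ρ e = x → (ρ' e : N) = p := fun e h => by simp [ρ', h]
    have hρ'n : ∀ e, ρ e ≠ x → (ρ' e : N) = ρ e := fun e h => by simp [ρ', h]
    -- Every path leaving `x` goes through `p`.
    have hpass : ∀ v z, z ≠ x → v ∈ bag x → v ∈ bag z → v ∈ bag p := by
      intro v z hz hvx hvz
      obtain ⟨q, hq, -⟩ := hT.existsUnique_path x z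
      cases q with
      | nil => exact (hz rfl).elim
      | cons h q =>
        obtain rfl := hp _ h
        exact hbag v _ _ hvx hvz _ hq _ (by simp)
    have hρ' : ∀ (v : V) (e f : G.edgeSet), v ∈ (e : Sym2 V) → v ∈ (f : Sym2 V) →
        ρ' e ≠ ρ' f → v ∈ bag (ρ' e) := by
      intro v e f he hf hef
      rw [Ne, ← Subtype.coe_inj] at hef
      by_cases h₁ : ρ e = x <;> by_cases h₂ : ρ f = x
      · rw [hρ'x e h₁, hρ'x f h₂] at hef
        exact (hef rfl).elim
      · rw [hρ'x e h₁]
        have hne : ρ e ≠ ρ f := fun h => h₂ (h ▸ h₁)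
        exact hpass v (ρ f) h₂ (h₁ ▸ hρ v e f he hf hne) (hρ v f e hf he hne.symm)
      · rw [hρ'n e h₁]
        exact hρ v e f he hf fun h => h₁ (h.trans h₂)
      · rw [hρ'n e h₁, hρ'n f h₂] at hef
        rw [hρ'n e h₁]
        exact hρ v e f he hf hef
    have hbd : ∀ y, (G.edgeBoundary (ρ' ⁻¹' {y})).ncard ≤ k := by
      intro y
      refine le_trans ?_ (hk y)
      rw [← Set.ncard_coe_finset]
      refine Set.ncard_le_ncard ?_ (Set.toFinite _)
      rintro v ⟨e, rfl, f, hf, hve, hvf⟩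
      exact hρ' v e f hve hvf fun h => hf h.symm
    refine ih hT' ?_ (fun y => bag y) (fun y => hk y) ?_ ρ' hρ' fun y hy => ?_
    · have := Set.ncard_add_ncard_compl ({x} : Set N)
      rw [Set.ncard_singleton, hn, ← Nat.card_coe_set_eq] at this
      omega
    · intro v a b ha hb q hq z hz
      obtain ⟨q', hq', hs⟩ := hq.exists_isPath_support_eq_map_val
      refine hbag v a b ha hb q' hq' z ?_
      rw [hs]
      exact List.mem_map_of_mem hz
    · by_cases hyp : (y : N) = p
      · have hun : ρ' ⁻¹' {y} = ρ ⁻¹' {p} ∪ ρ ⁻¹' {x} := by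
          ext e
          simp only [Set.mem_preimage, Set.mem_singleton_iff, Set.mem_union, ← Subtype.coe_inj]
          by_cases h : ρ e = x
          · simp [hρ'x e h, hyp, h]
          · simp [hρ'n e h, hyp, h]
        have hb := hbd y
        rw [hun] at hy hb ⊢
        rcases (ρ ⁻¹' {p}).eq_empty_or_nonempty with h₁ | h₁ <;>
          rcases (ρ ⁻¹' {x}).eq_empty_or_nonempty with h₂ | h₂
        · simp [h₁, h₂] at hy
        · rw [h₁, Set.empty_union]
          exact hm x h₂
        · rw [h₂, Set.union_empty]
          exact hm p h₁
        · refine .union _ _ (hm p h₁) (hm x h₂) ?_ hb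
          exact Disjoint.preimage _ (by simpa using hpx)
      · have he : ρ' ⁻¹' {y} = ρ ⁻¹' {(y : N)} := by
          ext e
          simp only [Set.mem_preimage, Set.mem_singleton_iff, ← Subtype.coe_inj]
          by_cases h : ρ e = x
          · rw [hρ'x e h, h]
            exact ⟨fun h => (hyp h.symm).elim, fun h => (y.2 h.symm).elim⟩
          · rw [hρ'n e h]
        rw [he] at hy ⊢
        exact hm y hy

theorem binaryMergeable_of_forall_mem [Finite V] {k : ℕ} {B : Finset V} (hB : B.card ≤ k)
    (F : Set G.edgeSet) (hF : ∀ e ∈ F, ∀ v ∈ (e : Sym2 V), v ∈ B) (hne : F.Nonempty) :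
    BinaryMergeable (fun A => (G.edgeBoundary A).ncard ≤ k) F := by
  have hbd : ∀ A ⊆ F, (G.edgeBoundary A).ncard ≤ k := by
    intro A hA
    refine le_trans ?_ hB
    rw [← Set.ncard_coe_finset]
    refine Set.ncard_le_ncard ?_ (Set.toFinite _)
    rintro v ⟨e, he, f, hf, hve, hvf⟩
    exact hF e (hA he) v hve
  suffices ∀ A ⊆ F, A.Nonempty →
      BinaryMergeable (fun A => (G.edgeBoundary A).ncard ≤ k) A from this F subset_rfl hne
  intro A hA hne
  induction A, Set.toFinite A using Set.Finite.induction_on with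
  | empty => simp at hne
  | @insert e A he _ ih =>
    rcases A.eq_empty_or_nonempty with rfl | h
    · rw [insert_empty_eq] at hA ⊢
      exact .singleton e (hbd _ hA)
    · have hb := hbd _ hA
      rw [Set.insert_eq] at hb ⊢
      refine .union _ _ (.singleton e (hbd _ ?_)) (ih ((Set.subset_insert e A).trans hA) h)
        (by simpa using he) hb
      exact (Set.singleton_subset_iff.2 (Set.mem_insert e A)).trans hA

end SimpleGraph

namespace TreeDecomposition

variable {V : Type u} {G : SimpleGraph V}

theorem mem_bag_of_mem_support (D : TreeDecomposition G) {v : V} {a b : D.Node}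
    (ha : v ∈ D.bag a) (hb : v ∈ D.bag b) {p : D.T.Walk a b} (hp : p.IsPath) {z : D.Node}
    (hz : z ∈ p.support) : v ∈ D.bag z := by
  obtain ⟨q, hq, -⟩ := (D.isTree_induce v).existsUnique_path ⟨a, ha⟩ ⟨b, hb⟩
  obtain ⟨q', hq', hs⟩ := hq.exists_isPath_support_eq_map_val
  rw [(D.isTree.existsUnique_path a b).unique hp hq', hs] at hz
  obtain ⟨w, -, rfl⟩ := List.mem_map.1 hz
  exact w.2

theorem card_bag_le (D : TreeDecomposition G) (x : D.Node) :
    ((D.bag x).card : ℤ) ≤ D.width + 1 := by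
  have := D.finite_node
  have h : (D.bag x).card ≤ ⨆ x, (D.bag x).card := le_ciSup (f := fun x => (D.bag x).card) (Set.finite_range _).bddAbove x
  rw [width]
  omega

theorem exists_branchDecomposition_width_le [Finite V] (D : TreeDecomposition G)
    (hE : 1 < G.edgeSet.ncard) : ∃ B : BranchDecomposition G, (B.width : ℤ) ≤ D.width + 1 := by
  have := D.finite_node
  have hk : ∀ x, (D.bag x).card ≤ (D.width + 1).toNat := fun x => by
    have := D.card_bag_le x
    omega
  have hex : ∀ e : G.edgeSet, ∃ x, ∀ v ∈ (e : Sym2 V), v ∈ D.bag x := by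
    rintro ⟨e, he⟩
    induction e with
    | _ v w =>
      obtain ⟨x, hv, hw⟩ := D.exists_bag v w he
      refine ⟨x, fun u hu => ?_⟩
      rcases Sym2.mem_iff.1 hu with rfl | rfl
      exacts [hv, hw]
  choose ρ hρ using hex
  have hne : (Set.univ : Set G.edgeSet).Nonempty := by
    obtain ⟨e, he⟩ := Set.nonempty_of_ncard_ne_zero (by omega : G.edgeSet.ncard ≠ 0)
    exact ⟨⟨e, he⟩, trivial⟩
  obtain ⟨B, hB⟩ := BranchDecomposition.exists_width_le
    (D.isTree.binaryMergeable_univ hne _ rfl D.bag hk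
      (fun v a b ha hb p hp z hz => D.mem_bag_of_mem_support ha hb hp hz) ρ
      (fun v e f hv _ _ => hρ e v hv)
      (fun x hx => SimpleGraph.binaryMergeable_of_forall_mem (hk x) _
        (fun e he v hv => by rw [← (he : ρ e = x)]; exact hρ e v hv) hx)) hE
  -- Some bag exists, so `D.width + 1` is nonnegative and `toNat` loses nothing.
  obtain ⟨x⟩ := D.isTree.connected.nonempty
  have := D.card_bag_le x
  exact ⟨B, by omega⟩

end TreeDecomposition

/-! ### From branch decompositions to tree decompositions. -/

namespace TreeDecomposition

open SimpleGraph

variable {V : Type u} {G : SimpleGraph V}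

/-- A tree decomposition in which some vertices are missing from all bags can be completed, if no
edges are missing. -/
theorem exists_width_le_of_bag [Finite V] {c : ℕ} (hc : 1 ≤ c) (n : ℕ) :
    ∀ {N : Type u} [Finite N] {T : SimpleGraph N} (_ : T.IsTree) (bag : N → Finset V)
      (_ : ∀ v, (T.induce {x | v ∈ bag x}).Connected ∨ ∀ x, v ∉ bag x)
      (_ : ∀ v w, G.Adj v w → ∃ x, v ∈ bag x ∧ w ∈ bag x) (_ : ∀ x, (bag x).card ≤ c)
      (_ : {v | ∀ x, v ∉ bag x}.ncard = n), ∃ D : TreeDecomposition G, D.width + 1 ≤ c := by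
  classical
  induction n with
  | zero =>
    intro N _ T hT bag hconn hedge hcard hn
    rw [Set.ncard_eq_zero (Set.toFinite _)] at hn
    refine ⟨{ Node := N
              finite_node := inferInstance
              T := T
              isTree := hT
              bag := bag
              isTree_induce := fun v =>
                ⟨(hconn v).resolve_right (Set.eq_empty_iff_forall_notMem.1 hn v),
                  hT.isAcyclic.induce _⟩
              exists_bag := hedge }, ?_⟩
    have : (⨆ x, (bag x).card) ≤ c := ciSup_le' hcard
    simp only [width]
    omega
  | succ n ih =>
    intro N _ T hT bag hconn hedge hcard hn
    obtain ⟨v, hv⟩ := Set.nonempty_of_ncard_ne_zero (by omega : {v | ∀ x, v ∉ bag x}.ncard ≠ 0)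
    obtain ⟨r⟩ := hT.connected.nonempty
    have hP : (⊥ : SimpleGraph PUnit.{u + 1}).IsTree := .of_subsingleton
    -- A new node with bag `{v}` is attached anywhere; `1 ≤ c` makes room for this bag.
    refine ih (hT.joinEdge hP (a := r) (b := ⟨⟩)) (Sum.elim bag fun _ => {v}) ?_ ?_ ?_ ?_
    · intro w
      by_cases hwv : w = v
      · subst hwv
        left
        have hs : Subsingleton {x | w ∈ Sum.elim bag (fun _ : PUnit.{u + 1} => {w}) x} := by
          refine ⟨?_⟩
          rintro ⟨x | x, hx⟩ ⟨y | y, hy⟩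
          exacts [(hv x hx).elim, (hv x hx).elim, (hv y hy).elim, rfl]
        have hne : Nonempty {x | w ∈ Sum.elim bag (fun _ : PUnit.{u + 1} => {w}) x} :=
          ⟨⟨Sum.inr ⟨⟩, by simp⟩⟩
        exact IsTree.of_subsingleton.connected
      · refine (hconn w).imp (fun h => ?_) fun h => ?_
        · refine h.map ⟨fun x => ⟨Sum.inl x.1, x.2⟩, fun {x y} hxy => ?_⟩ ?_
          · exact joinEdge_adj_inl_inl.2 hxy
          · rintro ⟨x | x, hx⟩
            · exact ⟨⟨x, hx⟩, rfl⟩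
            · exact (hwv (by simpa using hx)).elim
        · rintro (x | x)
          exacts [h x, by simpa using hwv]
    · intro a b hab
      obtain ⟨x, hx⟩ := hedge a b hab
      exact ⟨Sum.inl x, hx⟩
    · rintro (x | x)
      exacts [hcard x, by simpa using hc]
    · have : {w | ∀ x, w ∉ Sum.elim bag (fun _ : PUnit.{u + 1} => {v}) x} =
          {w | ∀ x, w ∉ bag x} \ {v} := by
        ext w
        simp
      rw [this, Set.ncard_sdiff_singleton_of_mem hv, hn, Nat.add_sub_cancel]

end TreeDecomposition

namespace SimpleGraph

variable {N : Type*} {T : SimpleGraph N}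

/-- A path avoiding `t` would be a second path from `a` to `b` in the tree. -/
theorem IsTree.not_reachable_deleteEdges (hT : T.IsTree) {a b : N} {p : T.Walk a b}
    (hp : p.IsPath) {t : Sym2 N} (ht : t ∈ p.edges) : ¬ (T.deleteEdges {t}).Reachable a b := by
  rintro h
  obtain ⟨q, hq⟩ := h.exists_isPath
  have hle := T.deleteEdges_le {t}
  rw [(hT.existsUnique_path a b).unique hp (hq.mapLe hle), Walk.edges_mapLe_eq_edges] at ht
  have := q.edges_subset_edgeSet ht
  simp at this

theorem Walk.IsPath.ncard_neighborSet_toSubgraph {a b x : N} {p : T.Walk a b} (hp : p.IsPath)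
    (hx : x ∈ p.support) (ha : x ≠ a) (hb : x ≠ b) : (p.toSubgraph.neighborSet x).ncard = 2 := by
  obtain ⟨i, rfl, hi⟩ := Walk.mem_support_iff_exists_getVert.1 hx
  refine hp.ncard_neighborSet_toSubgraph_internal_eq_two ?_ (lt_of_le_of_ne hi ?_)
  · rintro rfl
    simp at ha
  · rintro rfl
    simp at hb

end SimpleGraph

namespace BranchDecomposition

open SimpleGraph

variable {V : Type u} {G : SimpleGraph V} (D : BranchDecomposition G)

/-- The nodes on the paths between leaves assigned to edges at `v`. -/
def span (v : V) : Set D.Node :=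
  {x | ∃ e f : G.edgeSet, v ∈ (e : Sym2 V) ∧ v ∈ (f : Sym2 V) ∧
    ∃ p : D.T.Walk (D.leaf e) (D.leaf f), p.IsPath ∧ x ∈ p.support}

variable {D} {v : V}

theorem leaf_mem_span {e : G.edgeSet} (he : v ∈ (e : Sym2 V)) : (D.leaf e : D.Node) ∈ D.span v :=
  ⟨e, e, he, he, .nil, .nil, by simp⟩

theorem connected_induce_span {e : G.edgeSet} (he : v ∈ (e : Sym2 V)) :
    (D.T.induce (D.span v)).Connected := by
  classical
  refine induce_connected_of_patches _ (leaf_mem_span he) ?_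
  rintro x ⟨f, g, hf, hg, p, hp, hx⟩
  obtain ⟨q, hq, -⟩ := D.isTree.existsUnique_path (D.leaf e) (D.leaf f)
  -- The walk from the fixed leaf to `x` goes through a leaf of another edge at `v`, so it stays
  -- inside the span.
  let w := q.append (p.takeUntil x hx)
  refine ⟨{z | z ∈ w.support}, ?_, w.start_mem_support, w.end_mem_support,
    w.connected_induce_support _ _⟩
  intro z hz
  rcases (Walk.mem_support_append_iff _ _).1 hz with hz | hz
  · exact ⟨e, f, he, hf, q, hq, hz⟩
  · exact ⟨f, g, hf, hg, p, hp, p.support_takeUntil_subset_support hx hz⟩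

/-- An internal node of a path has two neighbours on it, so a leaf can only be an end of the path.
-/
theorem mem_of_leaf_mem_span {e : G.edgeSet} (h : (D.leaf e : D.Node) ∈ D.span v) :
    v ∈ (e : Sym2 V) := by
  obtain ⟨f, g, hf, hg, p, hp, hx⟩ := h
  by_cases h₁ : (D.leaf e : D.Node) = D.leaf f
  · rwa [D.leaf.injective (Subtype.ext h₁)]
  by_cases h₂ : (D.leaf e : D.Node) = D.leaf g
  · rwa [D.leaf.injective (Subtype.ext h₂)]
  have := D.finite_node
  have h := hp.ncard_neighborSet_toSubgraph hx h₁ h₂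
  have h' := Set.ncard_le_ncard (p.toSubgraph.neighborSet_subset (D.leaf e)) (Set.toFinite _)
  have := (D.leaf e).2
  omega

/-- A path between leaves of edges at `v` has `x` as an internal node, and each of its two edges at
`x` separates those leaves. -/
theorem two_le_ncard_across {x : D.Node} (hv : x ∈ D.span v)
    (hx : (D.T.neighborSet x).ncard ≠ 1) :
    2 ≤ {y | D.T.Adj x y ∧ D.Across v s(x, y)}.ncard := by
  obtain ⟨f, g, hf, hg, p, hp, hxp⟩ := hv
  have := D.finite_node
  rw [← hp.ncard_neighborSet_toSubgraph hxp (by rintro rfl; exact hx (D.leaf f).2)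
    (by rintro rfl; exact hx (D.leaf g).2)]
  refine Set.ncard_le_ncard (fun y hy => ?_) (Set.toFinite _)
  rw [Subgraph.mem_neighborSet, ← Subgraph.mem_edgeSet, Walk.mem_edges_toSubgraph] at hy
  exact ⟨p.edges_subset_edgeSet hy, f, g, hf, hg, D.isTree.not_reachable_deleteEdges hp hy⟩

theorem order_le_width {t : Sym2 D.Node} (ht : t ∈ D.T.edgeSet) : D.order t ≤ D.width := by
  have := D.finite_node
  exact le_ciSup (f := fun t : D.T.edgeSet => D.order t) (Set.finite_range _).bddAbove ⟨t, ht⟩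

theorem two_mul_ncard_span_le [Finite V] (hD : 2 ≤ D.width) (x : D.Node) :
    2 * {v | x ∈ D.span v}.ncard ≤ 3 * D.width := by
  classical
  have := D.finite_node
  rcases eq_or_ne (D.T.neighborSet x).ncard 1 with h | h
  · obtain ⟨e, he⟩ := D.leaf.surjective ⟨x, h⟩
    obtain rfl : (D.leaf e : D.Node) = x := congrArg Subtype.val he
    have h₁ : {v | (D.leaf e : D.Node) ∈ D.span v}.ncard ≤ {v | v ∈ (e : Sym2 V)}.ncard :=
      Set.ncard_le_ncard (fun v hv => mem_of_leaf_mem_span hv) (Set.toFinite _)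
    have h₂ : {v | v ∈ (e : Sym2 V)}.ncard ≤ 2 := by
      induction (e : Sym2 V) with
      | _ a b =>
        have : {v | v ∈ s(a, b)} = {a, b} := by ext; simp
        rw [this]
        exact (Set.ncard_insert_le a {b}).trans (by rw [Set.ncard_singleton])
    -- Only here is `2 ≤ D.width` needed: `2 * 2 ≤ 3 * D.width`.
    omega
  · have h₃ := (D.degree_eq x).resolve_right h
    -- Double count the pairs of a vertex in the bag and an edge at `x` that it is across.
    have := Finset.card_mul_le_card_mul (fun v y => D.Across v s(x, y)) (m := 2) (n := D.width)
      (s := (Set.toFinite {v | x ∈ D.span v}).toFinset)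
      (t := (Set.toFinite (D.T.neighborSet x)).toFinset) ?_ ?_
    · rw [← Set.ncard_eq_toFinset_card, ← Set.ncard_eq_toFinset_card, h₃] at this
      omega
    · intro v hv
      refine (two_le_ncard_across (by simpa using hv) h).trans (le_of_eq ?_)
      rw [← Set.ncard_coe_finset]
      congr 1
      ext y
      simp
    · intro y hy
      refine le_trans ?_ (order_le_width (t := s(x, y)) (by simpa using hy))
      rw [order, ← Set.ncard_coe_finset]
      refine Set.ncard_le_ncard (fun v hv => ?_) (Set.toFinite _)
      exact (Finset.mem_bipartiteBelow _ |>.1 (Finset.mem_coe.1 hv)).2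

theorem exists_treeDecomposition_width_le [Finite V] (hD : 2 ≤ D.width) :
    ∃ T : TreeDecomposition G, 2 * (T.width + 1) ≤ 3 * D.width := by
  classical
  have := D.finite_node
  let bag : D.Node → Finset V := fun x => (Set.toFinite {v | x ∈ D.span v}).toFinset
  have hbag : ∀ x v, v ∈ bag x ↔ x ∈ D.span v := fun x v => by simp [bag]
  have hconn : ∀ v, (D.T.induce {x | v ∈ bag x}).Connected ∨ ∀ x, v ∉ bag x := by
    intro v
    by_cases h : ∃ e : G.edgeSet, v ∈ (e : Sym2 V)
    · obtain ⟨e, he⟩ := h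
      have hs : {x | v ∈ bag x} = D.span v := Set.ext fun x => hbag x v
      rw [hs]
      exact .inl (connected_induce_span he)
    · refine .inr fun x hx => ?_
      obtain ⟨e, f, he, -⟩ := (hbag x v).1 hx
      exact h ⟨e, he⟩
  have hedge : ∀ v w, G.Adj v w → ∃ x, v ∈ bag x ∧ w ∈ bag x := fun v w h =>
    ⟨D.leaf ⟨s(v, w), h⟩, (hbag _ _).2 (leaf_mem_span (Sym2.mem_mk_left v w)),
      (hbag _ _).2 (leaf_mem_span (Sym2.mem_mk_right v w))⟩
  have hcard : ∀ x, (bag x).card ≤ 3 * D.width / 2 := by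
    intro x
    have := two_mul_ncard_span_le hD x
    rw [← Set.ncard_eq_toFinset_card]
    omega
  obtain ⟨T, hT⟩ := TreeDecomposition.exists_width_le_of_bag (by omega) _ D.isTree bag
    hconn hedge hcard rfl
  exact ⟨T, by omega⟩

end BranchDecomposition

/-! ### Passing to the minima. -/

theorem treewidth_le {V : Type u} [Finite V] {G : SimpleGraph V} (D : TreeDecomposition G) :
    treewidth G ≤ D.width := by
  refine csInf_le ⟨-1, ?_⟩ ⟨D, rfl⟩
  rintro _ ⟨D, rfl⟩
  simp only [TreeDecomposition.width]
  omega

theorem exists_width_eq_treewidth {V : Type u} [Finite V] {G : SimpleGraph V}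
    (h : Nonempty (TreeDecomposition G)) : ∃ D : TreeDecomposition G, D.width = treewidth G := by
  refine Int.csInf_mem (s := Set.range fun D : TreeDecomposition G => D.width)
    (Set.range_nonempty _) ⟨-1, ?_⟩
  rintro _ ⟨D, rfl⟩
  simp only [TreeDecomposition.width]
  omega

theorem mainTheorem5 {V : Type u} [Finite V] (G : SimpleGraph V) (hG : 2 ≤ branchwidth G) :
    (branchwidth G : ℝ) ≤ (treewidth G : ℝ) + 1 ∧
      (treewidth G : ℝ) + 1 ≤ (3 / 2 : ℝ) * (branchwidth G : ℝ) := by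
  have hE : ¬ G.edgeSet.ncard ≤ 1 := by
    intro h
    rw [branchwidth, if_pos h] at hG
    omega
  have hbw : branchwidth G = sInf (Set.range fun D : BranchDecomposition G => D.width) :=
    if_neg hE
  obtain ⟨B, hB⟩ : ∃ B : BranchDecomposition G, B.width = branchwidth G := by
    rw [hbw] at hG ⊢
    -- In `ℕ` the infimum of the empty set is `0`, so branchwidth at least 2 provides a branch
    -- decomposition.
    exact Nat.sInf_mem (Nat.nonempty_of_pos_sInf (zero_lt_two.trans_le hG))
  obtain ⟨T, hT⟩ := B.exists_treeDecomposition_width_le (by omega)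
  obtain ⟨T', hT'⟩ := exists_width_eq_treewidth ⟨T⟩
  obtain ⟨B', hB'⟩ := T'.exists_branchDecomposition_width_le (by omega)
  have h₁ : branchwidth G ≤ B'.width := hbw ▸ Nat.sInf_le ⟨B', rfl⟩
  have h₂ := treewidth_le T
  have h₃ : (branchwidth G : ℤ) ≤ treewidth G + 1 := by omega
  have h₄ : 2 * (treewidth G + 1) ≤ 3 * (branchwidth G : ℤ) := by omega
  have h₃' : (branchwidth G : ℝ) ≤ (treewidth G : ℝ) + 1 := by exact_mod_cast h₃
  have h₄' : 2 * ((treewidth G : ℝ) + 1) ≤ 3 * (branchwidth G : ℝ) := by exact_mod_cast h₄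
  exact ⟨h₃', by linarith⟩
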